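/- Let $K$ be a field, $R=K[x_1,\dots,x_n]$ with a fixed admissible monomial ordering, let $\mathrm{lt}$ and $\mathrm{lc}$ denote head monomial and head coefficient, and let $F$ be a list of nonzero homogeneous polynomials of $R$. Consider the algorithm F5C on input $F$, which works as follows. \emph{Data.} A list $r$ of labeled polynomials $r_k=(\mathrm{Sig}(k),\mathrm{Poly}(k))$, $k\ge 1$, where a signature $\mu\mathbf e_\nu$ is a monomial with an index $\nu$ (ordered by index, then by monomial; $u\cdot\mu\mathbf e_\nu=(u\mu)\mathbf e_\nu$), and for every $\nu$ a list $\mathrm{Rules}_\nu$ of rules $(\mu,j)$. For $\mathrm{Sig}(k)=\mu_k\mathbf e_\nu$, $\mathrm{Find\_Rewriting}(u,k)$ returns the second entry $j$ of the last rule $(\mu,j)$ of $\mathrm{Rules}_\nu$ with $\mu\mid u\mu_k$, or $k$ if there is none; $\mathrm{Is\_Rewritable}(u,k)$ is true iff the result differs from $k$. \emph{Stages.} $F$ is sorted by increasing degree (ties by increasing head monomial). Initially $r=((\mathbf e_1,f_1/\mathrm{lc}(f_1)))$, $B=(f_1)$, $G_{prev}=\{1\}$, and there are no rules. For each further $f_i$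 in turn, one appends $(\mathbf e_N,f_i/\mathrm{lc}(f_i))$ to $r$, where $N=\#r$ after appending, and runs Partial\_Basis: put $G_{curr}=G_{prev}\cup\{N\}$ and let $P$ be the set of critical pairs of $N$ with the elements of $G_{prev}$. A critical pair of $k$ and $\ell$ is $(t,k,u,\ell,v)$ with $t=\mathrm{lcm}(\mathrm{lt}\,\mathrm{Poly}(k),\mathrm{lt}\,\mathrm{Poly}(\ell))$, $u=t/\mathrm{lt}\,\mathrm{Poly}(k)$, $v=t/\mathrm{lt}\,\mathrm{Poly}(\ell)$, the component of larger signature written first; it is discarded if $u\,\mathrm{Sig}(k)$ or $v\,\mathrm{Sig}(\ell)$ has index $N$ and a monomial divisible by the head monomial of some $\mathrm{Poly}(j)$, $j\in G_{prev}$. While $P\ne\emptyset$, remove from $P$ the pairs with $t$ of minimal degree and do the following. \begin{itemize} \item \emph{SPols} examines these pairs from smallest to largest $t$; among pairs with the same $t$ that are formed by the same $k$ with elements $\ell$ of $G_{prev}$, those with smaller $\ell$ come first, and further ties are broken arbitrarily. It rejects $(t,k,u,\ell,v)$ if $\mathrm{Is\_Rewritable}(u,k)$ or $\mathrm{Is\_Rewritable}(v,\ell)$;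 otherwise it appends the S-polynomial with signature $u\,\mathrm{Sig}(k)$ to $r$ and the corresponding rule (with the new index) to the rules. \item \emph{Reduction} processes the nonzero S-polynomials, always one, $k$, of minimal signature. $\mathrm{Poly}(k)$ is replaced by its normal form modulo $B$; if this is $0$, $k$ is dropped. Otherwise one looks for $j\in G_{curr}$ or $j$ already completed, such that $\mathrm{lt}\,\mathrm{Poly}(j)$ divides $\mathrm{lt}\,\mathrm{Poly}(k)$ with quotient $w$, $w\,\mathrm{Sig}(j)\ne\mathrm{Sig}(k)$, not $\mathrm{Is\_Rewritable}(w,j)$, and the monomial of $w\,\mathrm{Sig}(j)$ is not divisible by a head monomial of $\mathrm{Poly}(\ell)$, $\ell\in G_{prev}$. If there is none, $\mathrm{Poly}(k)$ is made monic and $k$ is completed. If $w\,\mathrm{Sig}(j)<\mathrm{Sig}(k)$, $\mathrm{Poly}(k)$ is replaced by its top-reduction by $\mathrm{Poly}(j)$, made monic, and $k$ is processed again. Otherwise the (monic) top-reduction is appended to $r$ with signature $w\,\mathrm{Sig}(j)$, the corresponding rule is added, and both $k$ and the new polynomial are processed. \item Each completed $k$ is put into $G_{curr}$, after its critical pairs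 with the elements of $G_{curr}$ have been put into $P$. \end{itemize} When $P=\emptyset$: if some $\mathrm{Poly}(k)$, $k\in G_{curr}$, is $1$, the output is $\{1\}$. Otherwise \emph{Setup\_Reduced\_Basis} lists the reduced Gröbner basis of the ideal generated by all $\mathrm{Poly}(k)$, $k\in G_{curr}$, in some order as $B=(B_1,\dots,B_M)$, sets $r=((\mathbf e_j,B_j))_{j=1}^M$ and $G_{prev}=\{1,\dots,M\}$, deletes all rules, and recreates the rules for $B$: for $1\le j<k\le M$, in increasing order of $j$, the rule $(\mathrm{lcm}(\mathrm{lt}B_j,\mathrm{lt}B_k)/\mathrm{lt}B_k,\,0)$ is put into $\mathrm{Rules}_k$ ($0$ being the index of a phantom polynomial). When the input is exhausted, the output is the set of elements of $B$. All choices left open are arbitrary. \textbf{Theorem.} There is no need to recreate the rewrite rules for $B$ in Setup\_Reduced\_Basis. That is: \begin{enumerate} \item In every execution of F5C, whenever SPols examines a pair $(t,k,u,\ell,v)$ and one of its two components is rewritable through a rule for $B$ (Find\_Rewriting returns $0$ for it), Is\_Rewritable also rejects the other component, and it does so even if all rules for $B$ are ignored. \item The executions of F5C and those of the variant in which Setup\_Reduced\_Basis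 deletes all rules but does not recreate the rules for $B$ correspond to each other step by step: deleting the rules for $B$ from the states is compatible with the steps in both directions (a reachable state $s$ of F5C and the state $\bar s$ without the rules for $B$ admit the same next steps, up to these rules), and every reachable state of the variant is obtained in this way. In particular F5C and the variant have the same possible outputs. \end{enumerate} -/

import Mathlib

open scoped MonomialOrder

noncomputable section

namespace F5C

/-- Monomials (power products) of `K[x₁, …, xₙ]`, written additively as exponent vectors:
multiplication is `+`, divisibility is `≤`, the least common multiple is `⊔`, and an exact
quotient is `-`. -/
abbrev Mono (n : ℕ) := Fin n →₀ ℕ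

/-- The polynomial ring `K[x₁, …, xₙ]`. -/
abbrev Poly (K : Type*) [Field K] (n : ℕ) := MvPolynomial (Fin n) K

/-- `p · lc(p)⁻¹` (which is `0` for `p = 0`). -/
def makeMonic {K : Type*} [Field K] {n : ℕ} (m : MonomialOrder (Fin n)) (p : Poly K n) :
    Poly K n :=
  MvPolynomial.C (m.leadingCoeff p)⁻¹ * p

/-- `B` lists, without repetition and in some order, the reduced Gröbner basis of `I`. -/
structure IsReducedGroebnerBasis {K : Type*} [Field K] {n : ℕ} (m : MonomialOrder (Fin n))
    (I : Ideal (Poly K n)) (B : List (Poly K n)) : Prop where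
  nodup : B.Nodup
  span_eq : Ideal.span {b | b ∈ B} = I
  exists_dvd : ∀ p ∈ I, p ≠ 0 → ∃ b ∈ B, m.degree b ≤ m.degree p
  monic : ∀ b ∈ B, m.leadingCoeff b = 1
  reduced : ∀ b ∈ B, ∀ b' ∈ B, b' ≠ b → ∀ e ∈ b.support, ¬ m.degree b' ≤ e

/-- `h` is a normal form (complete reduction) of `p` modulo the Gröbner basis `B`. -/
def IsNormalForm {K : Type*} [Field K] {n : ℕ} (m : MonomialOrder (Fin n))
    (B : List (Poly K n)) (p h : Poly K n) : Prop :=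
  p - h ∈ Ideal.span {b | b ∈ B} ∧ ∀ e ∈ h.support, ∀ b ∈ B, ¬ m.degree b ≤ e

/-- A signature `μ 𝐞_ν`, consisting of a monomial `μ` and an index `ν ≥ 1`. -/
@[ext] structure Sig (n : ℕ) where
  mono : Mono n
  idx : ℕ

/-- The natural signature `u · (μ 𝐞_ν) = (u μ) 𝐞_ν`. -/
def Sig.mul {n : ℕ} (u : Mono n) (a : Sig n) : Sig n := ⟨u + a.mono, a.idx⟩

/-- The ordering of signatures: first by index, then by monomial. -/
def Sig.lt {n : ℕ} (m : MonomialOrder (Fin n)) (a b : Sig n) : Prop :=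
  a.idx < b.idx ∨ (a.idx = b.idx ∧ a.mono ≺[m] b.mono)

/-- A labeled polynomial `r_k = (Sig(k), Poly(k))`. -/
structure Labeled (K : Type*) [Field K] (n : ℕ) where
  sig : Sig n
  poly : Poly K n

/-- A critical pair `(t, k, u, ℓ, v)`. -/
@[ext] structure CritPair (n : ℕ) where
  t : Mono n
  k : ℕ
  u : Mono n
  l : ℕ
  v : Mono n

/-- The point of the algorithm that has been reached:
* `outer`: the test of the main loop of Basis;
* `loop`: the test of the loop of Partial_Basis;
* `spol L N`: in SPols, `L` being the pairs still to be examined (in this order) and `N` the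
  indices of the nonzero S-polynomials created so far;
* `reduction todo done`: the test of the loop of Reduction;
* `halt G`: terminated with output `G`. -/
inductive Phase (K : Type*) [Field K] (n : ℕ) where
  | outer
  | loop
  | spol (L : List (CritPair n)) (N : Finset ℕ)
  | reduction (todo completed : Finset ℕ)
  | halt (G : Set (Poly K n))

/-- The state of the algorithm.
* `lp`: the list `r` of labeled polynomials (numbered from `1`);
* `rules ν`: the list `Rules_ν` of rewrite rules `(μ, j)`, in order of creation (a list that has
  not been created is represented by the empty list);
* `B`, `prev`, `cur`: the basis `B`, and the index sets `G_prev` and `G_curr`;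
* `idx`: the argument `i` of Partial_Basis;
* `pairs`: the set `P` of critical pairs;
* `rest`: the input polynomials that have not been treated yet. -/
structure State (K : Type*) [Field K] (n : ℕ) where
  lp : List (Labeled K n)
  rules : ℕ → List (Mono n × ℕ)
  B : List (Poly K n)
  prev : Finset ℕ
  cur : Finset ℕ
  idx : ℕ
  pairs : Set (CritPair n)
  rest : List (Poly K n)
  phase : Phase K n

namespace State

variable {K : Type*} [Field K] {n : ℕ}

/-- `r_k`, with numbering from `1`; the value at `0` stands for the phantom polynomial. -/
def get (s : State K n) : ℕ → Labeled K n
  | 0 => ⟨⟨0, 0⟩, 0⟩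
  | k + 1 => s.lp.getD k ⟨⟨0, 0⟩, 0⟩

/-- `Poly(k)`. -/
def poly (s : State K n) (k : ℕ) : Poly K n := (s.get k).poly

/-- `Sig(k)`. -/
def sig (s : State K n) (k : ℕ) : Sig n := (s.get k).sig

/-- The head monomial of `Poly(k)`. -/
def head (m : MonomialOrder (Fin n)) (s : State K n) (k : ℕ) : Mono n := m.degree (s.poly k)

/-- Replace `r_k` by `(Sig(k), p)`. -/
def setPoly (s : State K n) (k : ℕ) (p : Poly K n) : State K n :=
  { s with lp := s.lp.modify (k - 1) (fun r => { r with poly := p }) }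

/-- Append a labeled polynomial to `r`. -/
def append (s : State K n) (a : Sig n) (p : Poly K n) : State K n :=
  { s with lp := s.lp ++ [⟨a, p⟩] }

/-- Add_Rule: append `(μ, j)` to `Rules_ν`, where `a = μ 𝐞_ν`. -/
def addRule (s : State K n) (a : Sig n) (j : ℕ) : State K n :=
  { s with rules := Function.update s.rules a.idx (s.rules a.idx ++ [(a.mono, j)]) }

open Classical in
/-- Find_Rewriting: search `Rules_ν` backwards for a rule `(μ_j, j)` with `μ_j ∣ u μ_k`, where
`Sig(k) = μ_k 𝐞_ν`; return `j`, or `k` if there is none. -/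
def findRewriting (s : State K n) (u : Mono n) (k : ℕ) : ℕ :=
  match (s.rules (s.sig k).idx).reverse.find?
      (fun r => decide (r.1 ≤ u + (s.sig k).mono)) with
  | some r => r.2
  | none => k

/-- Is_Rewritable. -/
def IsRewritable (s : State K n) (u : Mono n) (k : ℕ) : Prop := s.findRewriting u k ≠ k

/-- The monomial `w` is top-reducible by `G_prev`. -/
def TopReducible (m : MonomialOrder (Fin n)) (s : State K n) (w : Mono n) : Prop :=
  ∃ j ∈ s.prev, s.head m j ≤ w

open Classical in
/-- Crit_Pair, applied to the indices `k` and `l`. -/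
def critPair (m : MonomialOrder (Fin n)) (s : State K n) (k l : ℕ) : Option (CritPair n) :=
  let t := s.head m k ⊔ s.head m l
  let u := t - s.head m k
  let v := t - s.head m l
  if (s.sig k).idx = s.idx ∧ s.TopReducible m (u + (s.sig k).mono) then none
  else if (s.sig l).idx = s.idx ∧ s.TopReducible m (v + (s.sig l).mono) then none
  else if Sig.lt m ((s.sig k).mul u) ((s.sig l).mul v) then some ⟨t, l, v, k, u⟩
  else some ⟨t, k, u, l, v⟩

/-- All critical pairs that Crit_Pair returns for `k` with the elements of `S`. -/
def newPairs (m : MonomialOrder (Fin n)) (s : State K n) (k : ℕ) (S : Finset ℕ) :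
    Set (CritPair n) :=
  {c | ∃ j ∈ S, s.critPair m k j = some c}

/-- `L` lists the critical pairs of smallest degree in the order in which SPols examines them:
from smallest to largest lcm and, between pairs with the same lcm formed by one polynomial `k`
with two elements of `G_prev`, the pair with the earlier element of `G_prev` first. (The order
of pairs with the same lcm is arbitrary otherwise.) -/
def IsBatch (m : MonomialOrder (Fin n)) (s : State K n) (L : List (CritPair n)) : Prop :=
  L.Nodup ∧
  (∃ d : ℕ, (∃ c ∈ s.pairs, c.t.degree = d) ∧ (∀ c ∈ s.pairs, d ≤ c.t.degree) ∧
    ∀ c, c ∈ L ↔ c ∈ s.pairs ∧ c.t.degree = d) ∧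
  L.Pairwise (fun c c' => c.t ≼[m] c'.t ∧
    (c.t = c'.t → c.k = c'.k → c.l ∈ s.prev → c'.l ∈ s.prev → c.l ≤ c'.l))

/-- Find_Reductor may return `j` for the polynomial `k`. -/
def IsReductor (m : MonomialOrder (Fin n)) (s : State K n) (k j : ℕ) : Prop :=
  s.head m j ≤ s.head m k ∧
  (s.sig j).mul (s.head m k - s.head m j) ≠ s.sig k ∧
  ¬ s.IsRewritable (s.head m k - s.head m j) j ∧
  ¬ s.TopReducible m ((s.head m k - s.head m j) + (s.sig j).mono)

/-- The (normalised) result of one top-reduction of `Poly(k)` by `Poly(j)`. -/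
def topReduce (m : MonomialOrder (Fin n)) (s : State K n) (k j : ℕ) : Poly K n :=
  makeMonic m (s.poly k -
    MvPolynomial.monomial (s.head m k - s.head m j)
      (m.leadingCoeff (s.poly k) * (m.leadingCoeff (s.poly j))⁻¹) * s.poly j)

/-- Start of a pass through the main loop: append `(𝐞_{#r+1}, f · lc(f)⁻¹)` to `r`, and begin
Partial_Basis for the new index `i = #r`. -/
def beginStage (m : MonomialOrder (Fin n)) (s : State K n) (f : Poly K n)
    (fs : List (Poly K n)) : State K n :=
  let i := s.lp.length + 1
  let s' : State K n := { s.append ⟨0, i⟩ (makeMonic m f) with idx := i, rest := fs }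
  { s' with cur := insert i s.prev, pairs := s'.newPairs m i s.prev, phase := .loop }

/-- One pass through the final `for` loop of Partial_Basis. -/
def absorb (m : MonomialOrder (Fin n)) (s : State K n) (k : ℕ) : State K n :=
  { s with pairs := s.pairs ∪ s.newPairs m k s.cur, cur := insert k s.cur }

/-- The rules recording the S-polynomials of `B`: for `j < k` the rule
`(lcm(lt B_j, lt B_k) / lt B_k, 0)` in `Rules_k`, in increasing order of `j`. (Positions in
`B` are numbered from `1`.) -/
def basisRules (m : MonomialOrder (Fin n)) (B : List (Poly K n)) (k : ℕ) :
    List (Mono n × ℕ) :=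
  if 1 ≤ k ∧ k ≤ B.length then
    (List.range (k - 1)).map (fun j =>
      (m.degree (B.getD j 0) ⊔ m.degree (B.getD (k - 1) 0) - m.degree (B.getD (k - 1) 0), 0))
  else []

/-- Setup_Reduced_Basis, when the reduced Gröbner basis is listed as `B`. With
`recreate = true` the rules for the S-polynomials of `B` are recreated; with
`recreate = false` this is skipped, and no rule is kept. -/
def setup (m : MonomialOrder (Fin n)) (recreate : Bool) (s : State K n)
    (B : List (Poly K n)) : State K n :=
  { s with
    lp := B.mapIdx (fun j b => ⟨⟨0, j + 1⟩, b⟩)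
    rules := if recreate then basisRules m B else fun _ => []
    B := B
    prev := Finset.Icc 1 B.length
    cur := Finset.Icc 1 B.length
    phase := .outer }

/-- Forget all rules that point to the phantom polynomial. -/
def erase (s : State K n) : State K n :=
  { s with rules := fun i => (s.rules i).filter (fun r => r.2 != 0) }

end State

/-- Initial states of F5C on the input `F`: the input is sorted by increasing total degree,
ties being broken by increasing head monomial, and the records are initialised with `f₁`. -/
def IsInit {K : Type*} [Field K] {n : ℕ} (m : MonomialOrder (Fin n)) (F : List (Poly K n))
    (s : State K n) : Prop :=
  ∃ (f : Poly K n) (fs : List (Poly K n)),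
    (f :: fs).Perm F ∧
    (f :: fs).Pairwise (fun p q => p.totalDegree < q.totalDegree ∨
      (p.totalDegree = q.totalDegree ∧ m.degree p ≼[m] m.degree q)) ∧
    s = { lp := [⟨⟨0, 1⟩, makeMonic m f⟩]
          rules := fun _ => []
          B := [f]
          prev := {1}
          cur := {1}
          idx := 1
          pairs := ∅
          rest := fs
          phase := .outer }

/-- One step of F5C, with (`recreate = true`) or without (`recreate = false`) the recreation of
the rules for `B` in Setup_Reduced_Basis. Choices that the algorithm leaves open are
nondeterministic. -/
inductive Step {K : Type*} [Field K] {n : ℕ} (m : MonomialOrder (Fin n)) (recreate : Bool) :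
    State K n → State K n → Prop
  /-- The main loop is finished. -/
  | output (s) (h : s.phase = .outer) (hr : s.rest = []) :
      Step m recreate s { s with phase := .halt {b | b ∈ s.B} }
  /-- The next input polynomial is taken, and Partial_Basis is called. -/
  | begin (s f fs) (h : s.phase = .outer) (hr : s.rest = f :: fs) :
      Step m recreate s (s.beginStage m f fs)
  /-- Partial_Basis calls SPols on the critical pairs of smallest degree. -/
  | batch (s L) (h : s.phase = .loop) (hL : s.IsBatch m L) :
      Step m recreate s { s with pairs := s.pairs \ {c | c ∈ L}, phase := .spol L ∅ }
  /-- SPols rejects a pair with a rewritable component. -/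
  | reject (s c L N) (h : s.phase = .spol (c :: L) N)
      (hc : s.IsRewritable c.u c.k ∨ s.IsRewritable c.v c.l) :
      Step m recreate s { s with phase := .spol L N }
  /-- SPols computes an S-polynomial, which is zero. -/
  | computeZero (s c L N) (h : s.phase = .spol (c :: L) N)
      (hk : ¬ s.IsRewritable c.u c.k) (hl : ¬ s.IsRewritable c.v c.l)
      (hs : m.sPolynomial (s.poly c.k) (s.poly c.l) = 0) :
      Step m recreate s
        { (s.append ((s.sig c.k).mul c.u) 0).addRule
            ((s.sig c.k).mul c.u) (s.lp.length + 1) with phase := .spol L N }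
  /-- SPols computes an S-polynomial, which is not zero. -/
  | compute (s c L N) (h : s.phase = .spol (c :: L) N)
      (hk : ¬ s.IsRewritable c.u c.k) (hl : ¬ s.IsRewritable c.v c.l)
      (hs : m.sPolynomial (s.poly c.k) (s.poly c.l) ≠ 0) :
      Step m recreate s
        { (s.append ((s.sig c.k).mul c.u) (m.sPolynomial (s.poly c.k) (s.poly c.l))).addRule
            ((s.sig c.k).mul c.u) (s.lp.length + 1) with
          phase := .spol L (insert (s.lp.length + 1) N) }
  /-- SPols is finished, and Reduction is called. -/
  | reduce (s N) (h : s.phase = .spol [] N) :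
      Step m recreate s { s with phase := .reduction N ∅ }
  /-- Reduction of the polynomial `k` of minimal signature to zero. -/
  | reduceZero (s todo completed k p) (h : s.phase = .reduction todo completed)
      (hk : k ∈ todo) (hmin : ∀ k' ∈ todo, ¬ (s.sig k').lt m (s.sig k))
      (hp : IsNormalForm m s.B (s.poly k) p) (hp0 : p = 0) :
      Step m recreate s { s.setPoly k p with phase := .reduction (todo.erase k) completed }
  /-- There is no reductor: the polynomial `k` is completed. -/
  | reduceDone (s todo completed k p) (h : s.phase = .reduction todo completed)
      (hk : k ∈ todo) (hmin : ∀ k' ∈ todo, ¬ (s.sig k').lt m (s.sig k))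
      (hp : IsNormalForm m s.B (s.poly k) p) (hp0 : p ≠ 0)
      (hj : ∀ j ∈ s.cur ∪ completed, ¬ (s.setPoly k p).IsReductor m k j) :
      Step m recreate s
        { s.setPoly k (makeMonic m p) with
          phase := .reduction (todo.erase k) (insert k completed) }
  /-- A top-reduction that preserves the signature. -/
  | reduceSafe (s todo completed k p j) (h : s.phase = .reduction todo completed)
      (hk : k ∈ todo) (hmin : ∀ k' ∈ todo, ¬ (s.sig k').lt m (s.sig k))
      (hp : IsNormalForm m s.B (s.poly k) p) (hp0 : p ≠ 0)
      (hj : j ∈ s.cur ∪ completed) (hred : (s.setPoly k p).IsReductor m k j)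
      (hlt : ((s.sig j).mul ((s.setPoly k p).head m k - (s.setPoly k p).head m j)).lt m
        (s.sig k)) :
      Step m recreate s
        { s.setPoly k ((s.setPoly k p).topReduce m k j) with
          phase := .reduction (insert k (todo.erase k)) completed }
  /-- A top-reduction that raises the signature creates a new polynomial and a new rule. -/
  | reduceUnsafe (s todo completed k p j) (h : s.phase = .reduction todo completed)
      (hk : k ∈ todo) (hmin : ∀ k' ∈ todo, ¬ (s.sig k').lt m (s.sig k))
      (hp : IsNormalForm m s.B (s.poly k) p) (hp0 : p ≠ 0)
      (hj : j ∈ s.cur ∪ completed) (hred : (s.setPoly k p).IsReductor m k j)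
      (hlt : ¬ ((s.sig j).mul ((s.setPoly k p).head m k - (s.setPoly k p).head m j)).lt m
        (s.sig k)) :
      Step m recreate s
        { ((s.setPoly k p).append
            ((s.sig j).mul ((s.setPoly k p).head m k - (s.setPoly k p).head m j))
            ((s.setPoly k p).topReduce m k j)).addRule
              ((s.sig j).mul ((s.setPoly k p).head m k - (s.setPoly k p).head m j))
              (s.lp.length + 1) with
          phase := .reduction (insert (s.lp.length + 1) (insert k (todo.erase k))) completed }
  /-- Reduction is finished: its output `Q`, taken in some order, enters `G_curr` and yields new
  critical pairs. -/
  | absorb (s) (completed : Finset ℕ) (Q : List ℕ) (h : s.phase = .reduction ∅ completed)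
      (hQ : Q.Nodup) (hQ' : Q.toFinset = completed) :
      Step m recreate s { Q.foldl (fun a k => a.absorb m k) s with phase := .loop }
  /-- Partial_Basis is finished, and has found the unit ideal. -/
  | unit (s) (h : s.phase = .loop) (hP : s.pairs = ∅) (h1 : ∃ k ∈ s.cur, s.poly k = 1) :
      Step m recreate s { s with phase := .halt {1} }
  /-- Partial_Basis is finished, and Setup_Reduced_Basis is called. -/
  | setup (s B) (h : s.phase = .loop) (hP : s.pairs = ∅) (h1 : ∀ k ∈ s.cur, s.poly k ≠ 1)
      (hB : IsReducedGroebnerBasis m (Ideal.span {p | ∃ k ∈ s.cur, p = s.poly k}) B) :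
      Step m recreate s (s.setup m recreate B)

/-- The states that occur in some execution of F5C on the input `F`. -/
def Reachable {K : Type*} [Field K] {n : ℕ} (m : MonomialOrder (Fin n)) (recreate : Bool)
    (F : List (Poly K n)) (s : State K n) : Prop :=
  ∃ s₀, IsInit m F s₀ ∧ Relation.ReflTransGen (Step m recreate) s₀ s

/-- Some execution of F5C on the input `F` terminates with output `G`. -/
def Outputs {K : Type*} [Field K] {n : ℕ} (m : MonomialOrder (Fin n)) (recreate : Bool)
    (F : List (Poly K n)) (G : Set (Poly K n)) : Prop :=
  ∃ s, Reachable m recreate F s ∧ s.phase = .halt G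

end F5C

end

/-! When SPols examines a pair, its first component `k` always lies in the current stage, whose
rules carry nonzero labels. So a rule for `B` can only hit a component `ℓ` in `G_prev`, and it then
comes from some `j < ℓ`. In that case `lt B_j` divides `t`, so the lcm of the pair of `k` and `j`
divides `t`, and its multiplier `u'` of `k` divides `u`. Since `u Sig(k)` is not top-reducible by
`G_prev`, neither is `u' Sig(k)`; hence the pair of `k` and `j` was not discarded. It precedes the
present pair by degree, by lcm or, for equal lcm, by `j < ℓ`. When it was examined, either its
S-polynomial left a rule with monomial that of `u' Sig(k)`, or it was rejected, and then, by
induction, its first component was rewritable. In both cases there is a rule younger than `k` that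
divides `u' Sig(k)`, hence `u Sig(k)`, so `k` is rewritable without any rule for `B`.

The induction is carried by the field `covered` of `IsStage`; the argument itself is
`IsStage.isRewritable_of_prev`. In Reduction the rules for `B` have no influence either, since a
normal form modulo `B` has no reductor in `G_prev` (`IsBasePart.not_isReductor`). Consequently
`State.erase` is a bisimulation on the states satisfying `Inv`: `Inv.step_erase` and
`Inv.exists_step_of_erase`. -/

namespace F5C

/-! ### Backward search in rule lists, access to labeled polynomials, erasure of rules. -/

section General

variable {K : Type*} [Field K] {n : ℕ} {m : MonomialOrder (Fin n)}

/-- Searching backwards a list with increasing labels finds the match with the largest label. -/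
theorem find?_reverse_eq_some {α : Type*} {l : List (α × ℕ)} {p : α × ℕ → Bool} {a : α × ℕ}
    (hl : l.Pairwise (fun x y => x.2 < y.2)) (h : l.reverse.find? p = some a) :
    a ∈ l ∧ p a = true ∧ ∀ r ∈ l, p r = true → r.2 ≤ a.2 := by
  refine ⟨by simpa using List.mem_of_find?_eq_some h, List.find?_some h, fun r hr hpr => ?_⟩
  obtain ⟨-, as, bs, hab, has⟩ := List.find?_eq_some_iff_append.1 h
  have hl' := List.pairwise_reverse.2 hl
  rw [hab, List.pairwise_append, List.pairwise_cons] at hl'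
  have hr' : r ∈ as ++ a :: bs := by rw [← hab]; simpa using hr
  rcases List.mem_append.1 hr' with h1 | h1
  · simpa [hpr] using has r h1
  · rcases List.mem_cons.1 h1 with rfl | h1
    · exact le_rfl
    · exact (hl'.2.1.1 r h1).le

theorem degree_makeMonic (p : Poly K n) : m.degree (makeMonic m p) = m.degree p := by
  by_cases hp : p = 0
  · simp [makeMonic, hp]
  · have h : (m.leadingCoeff p)⁻¹ ≠ 0 := inv_ne_zero (m.leadingCoeff_ne_zero_iff.2 hp)
    rw [makeMonic, m.degree_mul (MvPolynomial.C_ne_zero.2 h) hp, m.degree_C, zero_add]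

namespace State

theorem get_append (s : State K n) (a : Sig n) (p : Poly K n) {k : ℕ} (hk : k ≤ s.lp.length) :
    (s.append a p).get k = s.get k := by
  cases k with
  | zero => rfl
  | succ k => simp [get, append, List.getElem?_append_left (show k < s.lp.length by omega)]

theorem get_append_length (s : State K n) (a : Sig n) (p : Poly K n) :
    (s.append a p).get (s.lp.length + 1) = ⟨a, p⟩ := by
  simp [get, append]

theorem get_setPoly_of_ne (s : State K n) {k j : ℕ} (p : Poly K n) (hk : 1 ≤ k) (hj : j ≠ k) :
    (s.setPoly k p).get j = s.get j := by
  cases j with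
  | zero => rfl
  | succ j => simp [get, setPoly, show k - 1 ≠ j by omega]

theorem poly_setPoly_self (s : State K n) {k : ℕ} (p : Poly K n) (hk : 1 ≤ k)
    (hk' : k ≤ s.lp.length) : (s.setPoly k p).poly k = p := by
  obtain ⟨k, rfl⟩ : ∃ i, k = i + 1 := ⟨k - 1, by omega⟩
  simp [poly, get, setPoly, List.getElem?_eq_getElem (show k < s.lp.length by omega)]

theorem sig_setPoly (s : State K n) (k j : ℕ) (p : Poly K n) :
    (s.setPoly k p).sig j = s.sig j := by
  cases j with
  | zero => rfl
  | succ j =>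
    simp only [sig, get, setPoly, List.getD_eq_getElem?_getD, List.getElem?_modify]
    cases s.lp[j]? with
    | none => simp
    | some r => by_cases h : k - 1 = j <;> simp [h]

theorem length_setPoly (s : State K n) (k : ℕ) (p : Poly K n) :
    (s.setPoly k p).lp.length = s.lp.length := by
  simp [setPoly]

theorem critPair_cases {s : State K n} {k l : ℕ} {c : CritPair n}
    (h : s.critPair m k l = some c) : (c.k = k ∧ c.l = l) ∨ (c.k = l ∧ c.l = k) := by
  unfold critPair at h
  dsimp only at h
  split_ifs at h <;> cases h <;> simp

theorem erase_addRule (s : State K n) (a : Sig n) {j : ℕ} (hj : j ≠ 0) :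
    (s.addRule a j).erase = s.erase.addRule a j := by
  simp only [erase, addRule]
  congr 1
  funext i
  by_cases h : i = a.idx
  · subst h; simp [hj]
  · simp [h]

/-- Every recreated rule carries the label `0`, so nothing survives the filter. -/
theorem erase_setup (s : State K n) (B : List (Poly K n)) :
    (s.setup m true B).erase = s.erase.setup m false B := by
  simp only [erase, setup]
  congr 1
  funext i
  simp only [if_true, Bool.false_eq_true, if_false]
  refine List.filter_eq_nil_iff.2 fun r hr => ?_
  unfold basisRules at hr
  split_ifs at hr
  · obtain ⟨j, -, rfl⟩ := List.mem_map.1 hr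
    simp
  · cases hr

theorem erase_foldl_absorb (Q : List ℕ) (s : State K n) :
    (Q.foldl (fun a k => a.absorb m k) s).erase = Q.foldl (fun a k => a.absorb m k) s.erase := by
  induction Q generalizing s with
  | nil => rfl
  | cons k Q ih => exact ih (s.absorb m k)

end State

end General

section Invariant

variable {K : Type*} [Field K] {n : ℕ}

/-! ### The invariant. -/

/-- The part of the state that concerns the basis `B`, which occupies the positions `1, …, M`
of `r`. -/
structure IsBasePart (m : MonomialOrder (Fin n)) (s : State K n) (M : ℕ) : Prop where
  le_length : M ≤ s.lp.length
  prev_eq : s.prev = Finset.Icc 1 M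
  sig_eq : ∀ j, 1 ≤ j → j ≤ M → s.sig j = ⟨0, j⟩
  -- Only heads are compared: initially `B` holds `f₁` itself, while `r₁` is made monic.
  exists_head_eq : ∀ j, 1 ≤ j → j ≤ M → ∃ b ∈ s.B, m.degree b = s.head m j
  -- The list `M + 1` belongs to the current stage. The bound `ν ≤ M` forces all lists beyond it to
  -- be empty.
  rules_spec : ∀ ν, ν ≠ M + 1 → ∀ r ∈ s.rules ν, r.2 = 0 ∧ ∃ j, 1 ≤ j ∧ j < ν ∧ ν ≤ M ∧
    r.1 = s.head m j ⊔ s.head m ν - s.head m ν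

/-- The invariant of Partial_Basis for the index `M + 1`; `W` is the set of critical pairs that
have not been examined yet. -/
structure IsStage (m : MonomialOrder (Fin n)) (s : State K n) (M : ℕ) (W : Set (CritPair n)) :
    Prop extends IsBasePart m s M where
  idx_eq : s.idx = M + 1
  lt_length : M < s.lp.length
  prev_sub : ∀ j, 1 ≤ j → j ≤ M → j ∈ s.cur
  cur_sub : ∀ k ∈ s.cur, 1 ≤ k ∧ k ≤ s.lp.length
  sig_idx : ∀ k, M < k → k ≤ s.lp.length → (s.sig k).idx = M + 1
  -- The inequality is strict because the generator of the stage, at position `M + 1`, has no rule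
  -- of its own.
  rules_bound : ∀ r ∈ s.rules (M + 1), M + 1 < r.2 ∧ r.2 ≤ s.lp.length
  rules_pairwise : (s.rules (M + 1)).Pairwise (fun x y => x.2 < y.2)
  rule_mem : ∀ k, M + 1 < k → k ≤ s.lp.length → ((s.sig k).mono, k) ∈ s.rules (M + 1)
  -- Pairs with both components outside `G_prev` need no further data, since no rule for `B`
  -- concerns them.
  pending : ∀ c ∈ W, c.k ∈ s.cur ∧ M < c.k ∧ c.l ∈ s.cur ∧ (c.l ≤ M →
    c.t = s.head m c.k ⊔ s.head m c.l ∧ c.u = c.t - s.head m c.k ∧ c.v = c.t - s.head m c.l ∧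
    ¬ s.TopReducible m (c.u + (s.sig c.k).mono))
  -- The induction hypothesis of the main argument: a pair with `G_prev` that survives the discard
  -- test is still waiting, or a rule younger than `k` divides its signature.
  covered : ∀ k ∈ s.cur, M < k → ∀ j, 1 ≤ j → j ≤ M →
    ¬ s.TopReducible m (s.head m k ⊔ s.head m j - s.head m k + (s.sig k).mono) →
    ⟨s.head m k ⊔ s.head m j, k, s.head m k ⊔ s.head m j - s.head m k, j,
      s.head m k ⊔ s.head m j - s.head m j⟩ ∈ W ∨
    ∃ r ∈ s.rules (M + 1), k < r.2 ∧
      r.1 ≤ s.head m k ⊔ s.head m j - s.head m k + (s.sig k).mono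

/-- The elements of `S` are positions of polynomials of the current stage outside `G_curr`. -/
def IsFresh (s : State K n) (M : ℕ) (S : Finset ℕ) : Prop :=
  ∀ k ∈ S, M < k ∧ k ≤ s.lp.length ∧ k ∉ s.cur

/-- The invariant of F5C. -/
def Inv (m : MonomialOrder (Fin n)) (s : State K n) : Prop :=
  match s.phase with
  | .outer => IsBasePart m s s.lp.length ∧ s.rules (s.lp.length + 1) = []
  | .loop => ∃ M, IsStage m s M s.pairs
  | .spol L N => ∃ M, IsStage m s M (s.pairs ∪ {c | c ∈ L}) ∧ IsFresh s M N ∧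
      -- This and the next condition are what remains of `IsBatch` while the batch is being
      -- examined.
      (∀ c ∈ L, ∀ c' ∈ s.pairs, c.t.degree < c'.t.degree) ∧
      L.Pairwise (fun c c' => c.t ≼[m] c'.t ∧
        (c.t = c'.t → c.k = c'.k → c.l ∈ s.prev → c'.l ∈ s.prev → c.l ≤ c'.l))
  | .reduction todo completed => ∃ M, IsStage m s M s.pairs ∧ IsFresh s M todo ∧
      ∀ k ∈ completed, M < k ∧ k ≤ s.lp.length
  | .halt _ => True

variable {m : MonomialOrder (Fin n)} {s s' : State K n} {M : ℕ} {W : Set (CritPair n)}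

/-! ### Stability of the invariant under changes of the state. -/

theorem IsStage.congr (h : IsStage m s M W) (hlp : s'.lp = s.lp) (hr : s'.rules = s.rules)
    (hB : s'.B = s.B) (hp : s'.prev = s.prev) (hc : s'.cur = s.cur) (hi : s'.idx = s.idx) :
    IsStage m s' M W := by
  obtain ⟨lp, rules, B, prev, cur, idx, pairs, rest, phase⟩ := s
  obtain ⟨lp', rules', B', prev', cur', idx', pairs', rest', phase'⟩ := s'
  dsimp only at hlp hr hB hp hc hi
  subst hlp hr hB hp hc hi
  obtain ⟨⟨h1, h2, h3, h4, h5⟩, h6, h7, h8, h9, h10, h11, h12, h13, h14, h15⟩ := h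
  exact ⟨⟨h1, h2, h3, h4, h5⟩, h6, h7, h8, h9, h10, h11, h12, h13, h14, h15⟩

theorem IsBasePart.congr (h : IsBasePart m s M) (hlen : M ≤ s'.lp.length)
    (hget : ∀ k, 1 ≤ k → k ≤ M → s'.get k = s.get k)
    (hr : ∀ ν, ν ≠ M + 1 → s'.rules ν = s.rules ν) (hB : s'.B = s.B) (hp : s'.prev = s.prev) :
    IsBasePart m s' M where
  le_length := hlen
  prev_eq := hp.trans h.prev_eq
  sig_eq j h1 h2 := by rw [← h.sig_eq j h1 h2, State.sig, hget j h1 h2, State.sig]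
  exists_head_eq j h1 h2 := by
    rw [hB, State.head, State.poly, hget j h1 h2]
    exact h.exists_head_eq j h1 h2
  rules_spec ν hν r hrν := by
    rw [hr ν hν] at hrν
    obtain ⟨h0, j, h1, h2, h3, h4⟩ := h.rules_spec ν hν r hrν
    refine ⟨h0, j, h1, h2, h3, ?_⟩
    simp only [State.head, State.poly, hget j h1 (by omega), hget ν (by omega) h3]
    exact h4

theorem IsBasePart.topReducible_iff (h : IsBasePart m s M) (hp : s'.prev = s.prev)
    (hget : ∀ k, 1 ≤ k → k ≤ M → s'.get k = s.get k) (w : Mono n) :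
    s'.TopReducible m w ↔ s.TopReducible m w := by
  simp only [State.TopReducible, hp, h.prev_eq, State.head, State.poly]
  refine exists_congr fun j => and_congr_right fun hj => ?_
  rw [hget j (Finset.mem_Icc.1 hj).1 (Finset.mem_Icc.1 hj).2]

/-- The invariant of a stage is not affected by changes outside `G_curr`. -/
theorem IsStage.extend (h : IsStage m s M W) (hlen : s.lp.length ≤ s'.lp.length)
    (hget : ∀ k ∈ s.cur, s'.get k = s.get k)
    (hr : ∀ ν, ν ≠ M + 1 → s'.rules ν = s.rules ν)
    (hB : s'.B = s.B) (hp : s'.prev = s.prev) (hc : s'.cur = s.cur) (hi : s'.idx = s.idx)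
    (hsig : ∀ k, M < k → k ≤ s'.lp.length → (s'.sig k).idx = M + 1)
    (hbound : ∀ r ∈ s'.rules (M + 1), M + 1 < r.2 ∧ r.2 ≤ s'.lp.length)
    (hpw : (s'.rules (M + 1)).Pairwise (fun x y => x.2 < y.2))
    (hmem : ∀ k, M + 1 < k → k ≤ s'.lp.length → ((s'.sig k).mono, k) ∈ s'.rules (M + 1))
    (hsub : ∀ r ∈ s.rules (M + 1), r ∈ s'.rules (M + 1)) :
    IsStage m s' M W := by
  have hget' : ∀ k, 1 ≤ k → k ≤ M → s'.get k = s.get k :=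
    fun k h1 h2 => hget k (h.prev_sub k h1 h2)
  have hhead : ∀ k ∈ s.cur, s'.head m k = s.head m k := fun k hk => by
    simp only [State.head, State.poly, hget k hk]
  have hsg : ∀ k ∈ s.cur, s'.sig k = s.sig k := fun k hk => by
    simp only [State.sig, hget k hk]
  refine ⟨h.toIsBasePart.congr (h.le_length.trans hlen) hget' hr hB hp, hi.trans h.idx_eq,
    h.lt_length.trans_le hlen, ?_, ?_, hsig, hbound, hpw, hmem, ?_, ?_⟩
  · rw [hc]; exact h.prev_sub
  · rw [hc]; exact fun k hk => ⟨(h.cur_sub k hk).1, (h.cur_sub k hk).2.trans hlen⟩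
  · intro c hcW
    obtain ⟨h1, h2, h3, h4⟩ := h.pending c hcW
    rw [hc, hhead _ h1, hhead _ h3, hsg _ h1, h.topReducible_iff hp hget']
    exact ⟨h1, h2, h3, h4⟩
  · intro k hk hMk j hj1 hj2
    rw [hc] at hk
    rw [hhead k hk, hhead j (h.prev_sub j hj1 hj2), hsg k hk, h.topReducible_iff hp hget']
    intro ht
    exact (h.covered k hk hMk j hj1 hj2 ht).imp_right fun ⟨r, hr1, hr2⟩ => ⟨r, hsub r hr1, hr2⟩

/-- Outside `G_curr` a polynomial may change freely: the heads in `pending` and `covered` are those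
of elements of `G_curr`. -/
theorem IsStage.setPoly (h : IsStage m s M W) {k : ℕ} (p : Poly K n) (hk : M < k)
    (hkc : k ∉ s.cur) : IsStage m (s.setPoly k p) M W := by
  have hl := s.length_setPoly k p
  refine h.extend hl.ge (fun j hj => s.get_setPoly_of_ne p (by omega) ?_) (fun _ _ => rfl) rfl
    rfl rfl rfl ?_ ?_ h.rules_pairwise ?_ (fun _ hr => hr)
  · rintro rfl; exact hkc hj
  · simp only [hl, State.sig_setPoly]; exact h.sig_idx
  · rw [hl]; exact h.rules_bound
  · simp only [hl, State.sig_setPoly]; exact h.rule_mem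

theorem length_append_addRule (s : State K n) (a : Sig n) (p : Poly K n) (j : ℕ) :
    ((s.append a p).addRule a j).lp.length = s.lp.length + 1 := by
  simp [State.append, State.addRule]

theorem rules_append_addRule (s : State K n) (a : Sig n) (p : Poly K n) (j : ℕ) :
    ((s.append a p).addRule a j).rules a.idx = s.rules a.idx ++ [(a.mono, j)] := by
  simp [State.append, State.addRule]

/-- The new label is the largest one, so the list stays sorted, and the new polynomial owns a rule,
as `rule_mem` demands. -/
theorem IsStage.append_addRule (h : IsStage m s M W) {a : Sig n} (p : Poly K n)
    (ha : a.idx = M + 1) :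
    IsStage m ((s.append a p).addRule a (s.lp.length + 1)) M W := by
  have hl := length_append_addRule s a p (s.lp.length + 1)
  have hr := rules_append_addRule s a p (s.lp.length + 1)
  have hlt := h.lt_length
  rw [ha] at hr
  have hget : ∀ k, k ≤ s.lp.length →
      ((s.append a p).addRule a (s.lp.length + 1)).get k = s.get k :=
    fun k hk => s.get_append a p hk
  have hlast : ((s.append a p).addRule a (s.lp.length + 1)).get (s.lp.length + 1) = ⟨a, p⟩ :=
    s.get_append_length a p
  refine h.extend (by omega) (fun k hk => hget k (h.cur_sub k hk).2) ?_ rfl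
    rfl rfl rfl ?_ ?_ ?_ ?_ ?_
  · intro ν hν
    simp [State.append, State.addRule, ha, hν]
  · intro k hMk hk
    rw [hl] at hk
    rcases Nat.le_succ_iff.1 hk with hk | rfl
    · rw [State.sig, hget k hk]; exact h.sig_idx k hMk hk
    · rw [State.sig, hlast]; exact ha
  · intro r hrr
    rw [hr, List.mem_append, List.mem_singleton] at hrr
    rw [hl]
    rcases hrr with hrr | rfl
    · have := h.rules_bound r hrr
      omega
    · dsimp only; omega
  · rw [hr, List.pairwise_append]
    refine ⟨h.rules_pairwise, List.pairwise_singleton _ _, fun x hx y hy => ?_⟩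
    rw [List.mem_singleton.1 hy]
    have := h.rules_bound x hx
    dsimp only; omega
  · intro k hMk hk
    rw [hl] at hk
    rw [hr, List.mem_append, List.mem_singleton]
    rcases Nat.le_succ_iff.1 hk with hk | rfl
    · rw [State.sig, hget k hk]; exact Or.inl (h.rule_mem k hMk hk)
    · rw [State.sig, hlast]; exact Or.inr rfl
  · intro r hrr
    rw [hr]; exact List.mem_append_left _ hrr

/-! ### Rewritability in the current stage and in `G_prev`. -/

/-- A component of the current stage is rewritable iff some later rule applies to it. -/
theorem IsStage.isRewritable_iff (h : IsStage m s M W) {k : ℕ} (hk : M < k)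
    (hk' : k ≤ s.lp.length) (u : Mono n) :
    s.IsRewritable u k ↔ ∃ r ∈ s.rules (M + 1), k < r.2 ∧ r.1 ≤ u + (s.sig k).mono := by
  have hidx := h.sig_idx k hk hk'
  unfold State.IsRewritable State.findRewriting
  rw [hidx]
  split
  · rename_i a ha
    obtain ⟨h1, h2, h3⟩ := find?_reverse_eq_some h.rules_pairwise ha
    have h2' := of_decide_eq_true h2
    constructor
    · intro hne
      refine ⟨a, h1, ?_, h2'⟩
      have hb := h.rules_bound a h1
      -- For `k > M + 1` the rule of `k` itself matches, so the last match has label at least `k`;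
      -- for `k = M + 1` every label is larger.
      by_cases hkM : M + 1 < k
      · have h4 := h3 _ (h.rule_mem k hkM hk') (decide_eq_true le_add_self)
        dsimp only at h4; omega
      · omega
    · rintro ⟨r, hr1, hr2, hr3⟩
      have := h3 r hr1 (decide_eq_true hr3)
      omega
  · rename_i ha
    refine iff_of_false (fun hne => hne rfl) ?_
    rintro ⟨r, hr1, -, hr3⟩
    have := List.find?_eq_none.1 ha r (by simpa using hr1)
    exact this (decide_eq_true hr3)

theorem IsStage.findRewriting_ne_zero (h : IsStage m s M W) {k : ℕ} (hk : M < k)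
    (hk' : k ≤ s.lp.length) (u : Mono n) : s.findRewriting u k ≠ 0 := by
  unfold State.findRewriting
  rw [h.sig_idx k hk hk']
  split
  · rename_i a ha
    have := h.rules_bound a (find?_reverse_eq_some h.rules_pairwise ha).1
    omega
  · omega

/-- Labels in the current list are nonzero, so erasure leaves this list unchanged. -/
theorem IsStage.erase_isRewritable_iff (h : IsStage m s M W) {k : ℕ} (hk : M < k)
    (hk' : k ≤ s.lp.length) (u : Mono n) : s.erase.IsRewritable u k ↔ s.IsRewritable u k := by
  have hf : s.erase.rules (M + 1) = s.rules (M + 1) := by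
    refine List.filter_eq_self.2 fun r hr => ?_
    have := h.rules_bound r hr
    simp only [bne_iff_ne]; omega
  have hs : s.erase.sig k = s.sig k := rfl
  unfold State.IsRewritable State.findRewriting
  rw [hs, h.sig_idx k hk hk', hf]

theorem IsStage.not_erase_isRewritable (h : IsStage m s M W) {l : ℕ} (hl1 : 1 ≤ l)
    (hl : l ≤ M) (v : Mono n) : ¬ s.erase.IsRewritable v l := by
  have hf : s.erase.rules l = [] := by
    refine List.filter_eq_nil_iff.2 fun r hr => ?_
    simp [(h.rules_spec l (by omega) r hr).1]
  have hs : s.erase.sig l = ⟨0, l⟩ := h.sig_eq l hl1 hl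
  unfold State.IsRewritable State.findRewriting
  rw [hs, hf]
  simp

/-- Rewritability of a component in `G_prev` comes from an earlier element of `G_prev`. -/
theorem IsStage.exists_of_isRewritable (h : IsStage m s M W) {l : ℕ} (hl1 : 1 ≤ l)
    (hl : l ≤ M) {v : Mono n} (hv : s.IsRewritable v l) :
    ∃ j, 1 ≤ j ∧ j < l ∧ s.head m j ⊔ s.head m l - s.head m l ≤ v := by
  unfold State.IsRewritable State.findRewriting at hv
  rw [h.sig_eq l hl1 hl] at hv
  split at hv
  · rename_i a ha
    have h1 : a ∈ s.rules l := by simpa using List.mem_of_find?_eq_some ha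
    have h2 := List.find?_some ha
    obtain ⟨-, j, hj1, hj2, -, hj4⟩ := h.rules_spec l (by omega) a h1
    refine ⟨j, hj1, hj2, ?_⟩
    rw [← hj4]
    simpa using of_decide_eq_true h2
  · exact absurd rfl hv

/-- If the component in `G_prev` of the examined pair is rewritable, so is the other one. -/
theorem IsStage.isRewritable_of_prev {c : CritPair n} {L : List (CritPair n)}
    (h : IsStage m s M (s.pairs ∪ {x | x ∈ c :: L}))
    (hdeg : ∀ x ∈ c :: L, ∀ x' ∈ s.pairs, x.t.degree < x'.t.degree)
    (hpw : (c :: L).Pairwise (fun c c' => c.t ≼[m] c'.t ∧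
        (c.t = c'.t → c.k = c'.k → c.l ∈ s.prev → c'.l ∈ s.prev → c.l ≤ c'.l)))
    (hl : c.l ≤ M) (hv : s.IsRewritable c.v c.l) : s.IsRewritable c.u c.k := by
  obtain ⟨hkc, hMk, hlc, hpend⟩ := h.pending c (Or.inr (List.mem_cons_self ..))
  obtain ⟨ht, hu, hvt, hnt⟩ := hpend hl
  have hl1 := (h.cur_sub _ hlc).1
  obtain ⟨j, hj1, hjl, hjv⟩ := h.exists_of_isRewritable hl1 hl hv
  have hjM : j ≤ M := by omega
  have hlt : s.head m c.l ≤ c.t := ht ▸ le_sup_right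
  -- Multiplying the divisibility given by the rule by `lt B_ℓ` shows that `lt B_j` divides `t`.
  have hjt : s.head m j ≤ c.t := by
    have h1 : s.head m j ⊔ s.head m c.l ≤ c.v + s.head m c.l := tsub_le_iff_right.1 hjv
    rw [hvt, tsub_add_cancel_of_le hlt] at h1
    exact le_sup_left.trans h1
  have hkj : s.head m c.k ⊔ s.head m j ≤ c.t := sup_le (ht ▸ le_sup_left) hjt
  have hu' : s.head m c.k ⊔ s.head m j - s.head m c.k ≤ c.u := hu ▸ tsub_le_tsub_right hkj _
  rw [h.isRewritable_iff hMk (h.cur_sub _ hkc).2]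
  rcases h.covered c.k hkc hMk j hj1 hjM
    (fun ⟨i, hi1, hi2⟩ => hnt ⟨i, hi1, hi2.trans (add_le_add_left hu' _)⟩) with hW | ⟨r, h1, h2, h3⟩
  -- The pair of `k` and `j` cannot be waiting. In `P` its degree would exceed that of `t`, although
  -- its lcm divides `t`; it is not `c`, since `j < c.l`; later in the list its lcm would have to
  -- equal `t`, and the tie rule would give `c.l ≤ j`.
  · exfalso
    rcases hW with hW | hW
    · have h1 := hdeg c (List.mem_cons_self ..) _ hW
      have h2 := Finsupp.degree_mono hkj
      dsimp only at h1; omega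
    · rcases List.mem_cons.1 hW with hW | hW
      · have := congrArg CritPair.l hW
        dsimp only at this; omega
      · obtain ⟨h1, h2⟩ := (List.pairwise_cons.1 hpw).1 _ hW
        dsimp only at h1 h2
        have h3 : c.t = s.head m c.k ⊔ s.head m j :=
          m.toSyn.injective (le_antisymm h1 (m.toSyn_monotone hkj))
        have := h2 h3 rfl (by rw [h.prev_eq]; exact Finset.mem_Icc.2 ⟨hl1, hl⟩)
          (by rw [h.prev_eq]; exact Finset.mem_Icc.2 ⟨hj1, hjM⟩)
        omega
  · exact ⟨r, h1, h2, h3.trans (add_le_add_left hu' _)⟩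

/-! ### Preservation of the invariant by the steps. -/

/-- Once a pair has been examined and its first component is rewritable, it may be dropped. -/
theorem IsStage.drop {c : CritPair n} {L : List (CritPair n)} {P : Set (CritPair n)}
    (h : IsStage m s M (P ∪ {x | x ∈ c :: L}))
    (hr : c.l ≤ M → ∃ r ∈ s.rules (M + 1), c.k < r.2 ∧ r.1 ≤ c.u + (s.sig c.k).mono) :
    IsStage m s M (P ∪ {x | x ∈ L}) := by
  refine ⟨h.toIsBasePart, h.idx_eq, h.lt_length, h.prev_sub, h.cur_sub, h.sig_idx, h.rules_bound,
    h.rules_pairwise, h.rule_mem, ?_, ?_⟩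
  · intro x hx
    exact h.pending x (hx.imp_right fun hx => List.mem_cons_of_mem _ hx)
  · intro k hk hMk j hj1 hj2 ht
    rcases h.covered k hk hMk j hj1 hj2 ht with (hW | hW) | hW
    · exact Or.inl (Or.inl hW)
    · rcases List.mem_cons.1 hW with hW | hW
      · subst hW
        exact Or.inr (hr hj2)
      · exact Or.inl (Or.inr hW)
    · exact Or.inr hW

/-- Position `j` has signature index `j < M + 1`. Hence `k` is the first component, and only its
side can be discarded. -/
theorem IsStage.critPair_prev (h : IsStage m s M W) {k j : ℕ} (hk : M < k)
    (hk' : k ≤ s.lp.length) (hj1 : 1 ≤ j) (hj : j ≤ M) (c : CritPair n) :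
    s.critPair m k j = some c ↔
      ¬ s.TopReducible m (s.head m k ⊔ s.head m j - s.head m k + (s.sig k).mono) ∧
      c = ⟨s.head m k ⊔ s.head m j, k, s.head m k ⊔ s.head m j - s.head m k, j,
        s.head m k ⊔ s.head m j - s.head m j⟩ := by
  have h1 := h.sig_idx k hk hk'
  have h2 : (s.sig j).idx = j := by rw [h.sig_eq j hj1 hj]
  have h3 : ∀ u v : Mono n, ¬ Sig.lt m ((s.sig k).mul u) ((s.sig j).mul v) := by
    intro u v
    simp only [Sig.lt, Sig.mul, h1, h2]
    rintro (h | h) <;> omega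
  unfold State.critPair
  dsimp only
  rw [if_neg (fun hh : (s.sig j).idx = s.idx ∧ _ => by
    have := hh.1; rw [h2, h.idx_eq] at this; omega), if_neg (h3 _ _), h1, h.idx_eq]
  by_cases ht : s.TopReducible m (s.head m k ⊔ s.head m j - s.head m k + (s.sig k).mono)
  · simp [ht]
  · simp [ht, eq_comm]

/-- Since `G_prev ⊆ G_curr`, all surviving pairs of `k` with `G_prev` enter `P` at once; this gives
`covered` for `k`. -/
theorem IsStage.absorb (h : IsStage m s M s.pairs) {k : ℕ} (hk : M < k)
    (hk' : k ≤ s.lp.length) : IsStage m (s.absorb m k) M (s.absorb m k).pairs := by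
  refine ⟨⟨h.le_length, h.prev_eq, h.sig_eq, h.exists_head_eq, h.rules_spec⟩, h.idx_eq,
    h.lt_length, ?_, ?_, h.sig_idx, h.rules_bound, h.rules_pairwise, h.rule_mem, ?_, ?_⟩
  · exact fun j h1 h2 => Finset.mem_insert_of_mem (h.prev_sub j h1 h2)
  · intro j hj
    rcases Finset.mem_insert.1 hj with rfl | hj
    · exact ⟨by omega, hk'⟩
    · exact h.cur_sub j hj
  · rintro c (hc | ⟨j, hj, hc⟩)
    · obtain ⟨h1, h2, h3, h4⟩ := h.pending c hc
      exact ⟨Finset.mem_insert_of_mem h1, h2, Finset.mem_insert_of_mem h3, h4⟩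
    · by_cases hjM : j ≤ M
      · obtain ⟨ht, rfl⟩ := (h.critPair_prev hk hk' (h.cur_sub j hj).1 hjM c).1 hc
        exact ⟨Finset.mem_insert_self .., hk, Finset.mem_insert_of_mem hj,
          fun _ => ⟨rfl, rfl, rfl, ht⟩⟩
      · rcases State.critPair_cases hc with ⟨h1, h2⟩ | ⟨h1, h2⟩
        · rw [h1, h2]
          exact ⟨Finset.mem_insert_self .., hk, Finset.mem_insert_of_mem hj, fun h => absurd h hjM⟩
        · rw [h1, h2]
          exact ⟨Finset.mem_insert_of_mem hj, by omega, Finset.mem_insert_self .., fun h => by omega⟩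
  · intro i hi hMi j hj1 hj2 ht
    by_cases hik : i = k
    · subst hik
      exact Or.inl (Or.inr ⟨j, h.prev_sub j hj1 hj2,
        (h.critPair_prev hk hk' hj1 hj2 _).2 ⟨ht, rfl⟩⟩)
    · rcases h.covered i ((Finset.mem_insert.1 hi).resolve_left hik) hMi j hj1 hj2 ht with hW | hW
      · exact Or.inl (Or.inl hW)
      · exact Or.inr hW

theorem IsStage.foldl_absorb (Q : List ℕ) (h : IsStage m s M s.pairs)
    (hQ : ∀ k ∈ Q, M < k ∧ k ≤ s.lp.length) :
    IsStage m (Q.foldl (fun a k => a.absorb m k) s) M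
      (Q.foldl (fun a k => a.absorb m k) s).pairs := by
  induction Q generalizing s with
  | nil => exact h
  | cons k Q ih =>
    obtain ⟨h1, h2⟩ := hQ k (List.mem_cons_self ..)
    exact ih (h.absorb h1 h2) fun j hj => hQ j (List.mem_cons_of_mem _ hj)

/-- The start of a stage amounts to absorbing the new generator into a stage with `G_curr = G_prev`
and no pairs, where `covered` is vacuous. -/
theorem IsBasePart.isStage_beginStage (h : IsBasePart m s s.lp.length)
    (hr : s.rules (s.lp.length + 1) = []) (f : Poly K n) (fs : List (Poly K n)) :
    IsStage m (s.beginStage m f fs) s.lp.length (s.beginStage m f fs).pairs := by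
  have hl : (s.beginStage m f fs).lp.length = s.lp.length + 1 := by
    simp [State.beginStage, State.append]
  have hget : ∀ k, k ≤ s.lp.length → (s.beginStage m f fs).get k = s.get k :=
    fun k hk => s.get_append _ _ hk
  have hlast : (s.beginStage m f fs).get (s.lp.length + 1) =
      ⟨⟨0, s.lp.length + 1⟩, makeMonic m f⟩ := s.get_append_length _ _
  have hprev : (s.beginStage m f fs).prev = s.prev := rfl
  have hcur : (s.beginStage m f fs).cur = insert (s.lp.length + 1) s.prev := rfl
  have hr' : (s.beginStage m f fs).rules (s.lp.length + 1) = [] := hr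
  have hb : IsBasePart m (s.beginStage m f fs) s.lp.length :=
    h.congr (by omega) (fun k _ hk => hget k hk) (fun _ _ => rfl) rfl rfl
  -- The stage before any pair has been formed.
  have h0 : IsStage m { s.beginStage m f fs with cur := s.prev, pairs := ∅ } s.lp.length ∅ := by
    refine ⟨⟨hb.le_length, hb.prev_eq, hb.sig_eq, hb.exists_head_eq, hb.rules_spec⟩, rfl, ?_, ?_,
      ?_, ?_, ?_, ?_, ?_, fun c hc => hc.elim, ?_⟩
    · exact Nat.lt_of_succ_le hl.ge
    · intro j h1 h2
      change j ∈ s.prev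
      rw [h.prev_eq]
      exact Finset.mem_Icc.2 ⟨h1, h2⟩
    · intro k hk
      change k ∈ s.prev at hk
      rw [h.prev_eq, Finset.mem_Icc] at hk
      exact ⟨hk.1, hk.2.trans ((Nat.le_succ _).trans hl.ge)⟩
    · intro k h1 h2
      have h3 : k ≤ s.lp.length + 1 := h2.trans hl.le
      obtain rfl : k = s.lp.length + 1 := by omega
      exact congrArg (fun r : Labeled K n => r.sig.idx) hlast
    · intro r hrr
      rw [show State.rules _ _ = [] from hr'] at hrr
      cases hrr
    · rw [show State.rules _ _ = [] from hr']
      exact List.Pairwise.nil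
    · intro k h1 h2
      have h3 : k ≤ s.lp.length + 1 := h2.trans hl.le
      omega
    · intro k hk hMk
      change k ∈ s.prev at hk
      rw [h.prev_eq, Finset.mem_Icc] at hk
      omega
  have h1 := h0.absorb (k := s.lp.length + 1) (Nat.lt_succ_self _) hl.ge
  have hp : (State.absorb m { s.beginStage m f fs with cur := s.prev, pairs := ∅ }
      (s.lp.length + 1)).pairs = (s.beginStage m f fs).pairs := Set.empty_union _
  rw [hp] at h1
  exact h1.congr rfl rfl rfl rfl rfl rfl

theorem get_setup (s : State K n) (b : Bool) (B : List (Poly K n)) {k : ℕ} (hk : k < B.length) :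
    (s.setup m b B).get (k + 1) = ⟨⟨0, k + 1⟩, B.getD k 0⟩ := by
  simp [State.get, State.setup, hk]

theorem length_setup (s : State K n) (b : Bool) (B : List (Poly K n)) :
    (s.setup m b B).lp.length = B.length := by
  simp [State.setup]

theorem isBasePart_setup (s : State K n) (B : List (Poly K n)) :
    IsBasePart m (s.setup m true B) (s.setup m true B).lp.length := by
  have hl := length_setup (m := m) s true B
  have hget : ∀ k, 1 ≤ k → k ≤ B.length →
      (s.setup m true B).get k = ⟨⟨0, k⟩, B.getD (k - 1) 0⟩ := by
    intro k h1 h2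
    obtain ⟨k, rfl⟩ : ∃ i, k = i + 1 := ⟨k - 1, by omega⟩
    exact get_setup s true B (by omega)
  rw [hl]
  refine ⟨hl.ge, rfl, fun j h1 h2 => by rw [State.sig, hget j h1 h2], fun j h1 h2 => ?_,
    fun ν hν r hr => ?_⟩
  · refine ⟨B.getD (j - 1) 0, ?_, by rw [State.head, State.poly, hget j h1 h2]⟩
    rw [List.getD_eq_getElem _ _ (show j - 1 < B.length by omega)]
    exact List.getElem_mem _
  · change r ∈ State.basisRules m B ν at hr
    unfold State.basisRules at hr
    split_ifs at hr with hν'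
    · obtain ⟨j, hj, rfl⟩ := List.mem_map.1 hr
      rw [List.mem_range] at hj
      -- `basisRules` counts `j` from `0`, whereas positions in `r` start at `1`.
      refine ⟨rfl, j + 1, by omega, by omega, hν'.2, ?_⟩
      simp only [State.head, State.poly, hget (j + 1) (by omega) (by omega), hget ν hν'.1 hν'.2,
        Nat.add_sub_cancel]
    · cases hr

theorem IsInit.inv {F : List (Poly K n)} (h : IsInit m F s) : Inv m s := by
  obtain ⟨f, fs, -, -, rfl⟩ := h
  refine ⟨⟨le_rfl, rfl, ?_, ?_, fun _ _ _ hr => absurd hr List.not_mem_nil⟩, rfl⟩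
  · intro j h1 h2
    obtain rfl : j = 1 := le_antisymm h2 h1
    rfl
  · intro j h1 h2
    obtain rfl : j = 1 := le_antisymm h2 h1
    exact ⟨f, List.mem_singleton_self f, (degree_makeMonic f).symm⟩

theorem IsFresh.erase {S : Finset ℕ} (h : IsFresh s M S) (k : ℕ) : IsFresh s M (S.erase k) :=
  fun j hj => h j (Finset.mem_of_mem_erase hj)

theorem IsFresh.congr {S : Finset ℕ} (h : IsFresh s M S) (hl : s.lp.length ≤ s'.lp.length)
    (hc : s'.cur = s.cur) : IsFresh s' M S :=
  fun j hj => ⟨(h j hj).1, (h j hj).2.1.trans hl, hc ▸ (h j hj).2.2⟩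

theorem IsFresh.insert {S : Finset ℕ} (h : IsFresh s M S) {k : ℕ} (h1 : M < k)
    (h2 : k ≤ s.lp.length) (h3 : k ∉ s.cur) : IsFresh s M (insert k S) := by
  intro j hj
  rcases Finset.mem_insert.1 hj with rfl | hj
  · exact ⟨h1, h2, h3⟩
  · exact h j hj

/-- The S-polynomial of an examined pair is recorded. -/
theorem IsStage.compute {c : CritPair n} {L : List (CritPair n)} {P : Set (CritPair n)}
    (h : IsStage m s M (P ∪ {x | x ∈ c :: L})) (p : Poly K n) :
    IsStage m ((s.append ((s.sig c.k).mul c.u) p).addRule ((s.sig c.k).mul c.u)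
      (s.lp.length + 1)) M (P ∪ {x | x ∈ L}) := by
  obtain ⟨hkc, hMk, -, -⟩ := h.pending c (Or.inr (List.mem_cons_self ..))
  have hk' := (h.cur_sub _ hkc).2
  have ha : ((s.sig c.k).mul c.u).idx = M + 1 := h.sig_idx _ hMk hk'
  -- The new rule has exactly the monomial of the pair's signature, and its label exceeds every
  -- position in use.
  refine (h.append_addRule p ha).drop fun _ => ⟨(((s.sig c.k).mul c.u).mono, s.lp.length + 1), ?_, ?_, ?_⟩
  · have := rules_append_addRule s ((s.sig c.k).mul c.u) p (s.lp.length + 1)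
    rw [ha] at this
    rw [this]
    exact List.mem_append_right _ (List.mem_singleton_self _)
  · dsimp only; omega
  · have : ((s.append ((s.sig c.k).mul c.u) p).addRule ((s.sig c.k).mul c.u)
        (s.lp.length + 1)).sig c.k = s.sig c.k :=
      congrArg Labeled.sig (s.get_append ((s.sig c.k).mul c.u) p hk')
    rw [this]
    exact le_rfl

/-- The elements of `G_prev` are not reductors of a normal form modulo `B`. -/
theorem IsBasePart.not_isReductor (h : IsBasePart m s M) {k j : ℕ} {p q : Poly K n} (hk : M < k)
    (hk' : k ≤ s.lp.length) (hp : IsNormalForm m s.B q p) (hp0 : p ≠ 0) (hj1 : 1 ≤ j)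
    (hj : j ≤ M) : ¬ (s.setPoly k p).head m j ≤ (s.setPoly k p).head m k := by
  obtain ⟨b, hb, hbj⟩ := h.exists_head_eq j hj1 hj
  rw [State.head, State.head, State.poly, s.get_setPoly_of_ne p (by omega) (by omega),
    s.poly_setPoly_self p (by omega) hk']
  change ¬ s.head m j ≤ m.degree p
  rw [← hbj]
  exact hp.2 _ (m.degree_mem_support hp0) b hb

theorem Inv.step (h : Inv m s) (hs : Step m true s s') : Inv m s' := by
  cases hs with
  | output hph hr => exact trivial
  | begin f fs hph hr =>
    simp only [Inv, hph] at h
    exact ⟨_, h.1.isStage_beginStage h.2 f fs⟩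
  | batch L hph hL =>
    simp only [Inv, hph] at h
    obtain ⟨M, h⟩ := h
    obtain ⟨-, ⟨d, -, hd, hLd⟩, hpw⟩ := hL
    refine ⟨M, ?_, fun k hk => absurd hk (Finset.notMem_empty k), ?_, hpw⟩
    -- Moving pairs from `P` to the batch does not change the set of waiting pairs.
    · have : s.pairs \ {c | c ∈ L} ∪ {c | c ∈ L} = s.pairs :=
        Set.sdiff_union_of_subset fun c hc => ((hLd c).1 hc).1
      dsimp only
      rw [this]
      exact h.congr rfl rfl rfl rfl rfl rfl
    · rintro c hc c' ⟨hc', hcL⟩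
      have h1 := ((hLd c).1 hc).2
      have h2 := hd c' hc'
      have h3 : c'.t.degree ≠ d := fun h => hcL ((hLd c').2 ⟨hc', h⟩)
      omega
  | reject c L N hph hc =>
    simp only [Inv, hph] at h
    obtain ⟨M, h, hN, hdeg, hpw⟩ := h
    obtain ⟨hkc, hMk, -, -⟩ := h.pending c (Or.inr (List.mem_cons_self ..))
    refine ⟨M, (h.drop fun hl => ?_).congr rfl rfl rfl rfl rfl rfl, hN,
      fun x hx => hdeg x (List.mem_cons_of_mem _ hx), (List.pairwise_cons.1 hpw).2⟩
    rw [← h.isRewritable_iff hMk (h.cur_sub _ hkc).2]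
    -- Even a rejection caused by the second component provides a rule for the first one; this
    -- closes the induction.
    exact hc.elim id (h.isRewritable_of_prev hdeg hpw hl)
  | computeZero c L N hph hk hl hs =>
    simp only [Inv, hph] at h
    obtain ⟨M, h, hN, hdeg, hpw⟩ := h
    refine ⟨M, (h.compute 0).congr rfl rfl rfl rfl rfl rfl, ?_,
      fun x hx => hdeg x (List.mem_cons_of_mem _ hx), (List.pairwise_cons.1 hpw).2⟩
    exact hN.congr ((Nat.le_succ _).trans (length_append_addRule _ _ _ (s.lp.length + 1)).ge) rfl
  | compute c L N hph hk hl hs =>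
    simp only [Inv, hph] at h
    obtain ⟨M, h, hN, hdeg, hpw⟩ := h
    refine ⟨M, (h.compute _).congr rfl rfl rfl rfl rfl rfl, ?_,
      fun x hx => hdeg x (List.mem_cons_of_mem _ hx), (List.pairwise_cons.1 hpw).2⟩
    refine (hN.congr ((Nat.le_succ _).trans (length_append_addRule _ _ _ (s.lp.length + 1)).ge) rfl).insert
      (h.lt_length.trans (Nat.lt_succ_self _)) (length_append_addRule _ _ _ (s.lp.length + 1)).ge fun hc => ?_
    exact absurd (h.cur_sub _ hc).2 (Nat.not_succ_le_self _)
  | reduce N hph =>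
    simp only [Inv, hph] at h
    obtain ⟨M, h, hN, -, -⟩ := h
    have : s.pairs ∪ {c | c ∈ ([] : List (CritPair n))} = s.pairs := by simp
    rw [this] at h
    exact ⟨M, h.congr rfl rfl rfl rfl rfl rfl, hN, fun k hk => absurd hk (Finset.notMem_empty k)⟩
  | reduceZero todo completed k p hph hk hmin hp hp0 =>
    simp only [Inv, hph] at h
    obtain ⟨M, h, hT, hC⟩ := h
    obtain ⟨hMk, hkl, hkc⟩ := hT k hk
    have hl := s.length_setPoly k p
    exact ⟨M, (h.setPoly p hMk hkc).congr rfl rfl rfl rfl rfl rfl,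
      (hT.erase k).congr hl.ge rfl, fun j hj => ⟨(hC j hj).1, (hC j hj).2.trans hl.ge⟩⟩
  | reduceDone todo completed k p hph hk hmin hp hp0 hj =>
    simp only [Inv, hph] at h
    obtain ⟨M, h, hT, hC⟩ := h
    obtain ⟨hMk, hkl, hkc⟩ := hT k hk
    have hl := s.length_setPoly k (makeMonic m p)
    refine ⟨M, (h.setPoly _ hMk hkc).congr rfl rfl rfl rfl rfl rfl,
      (hT.erase k).congr hl.ge rfl, fun j hj => ?_⟩
    rcases Finset.mem_insert.1 hj with rfl | hj
    · exact ⟨hMk, hkl.trans hl.ge⟩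
    · exact ⟨(hC j hj).1, (hC j hj).2.trans hl.ge⟩
  | reduceSafe todo completed k p j hph hk hmin hp hp0 hj hred hlt =>
    simp only [Inv, hph] at h
    obtain ⟨M, h, hT, hC⟩ := h
    obtain ⟨hMk, hkl, hkc⟩ := hT k hk
    have hl := s.length_setPoly k ((s.setPoly k p).topReduce m k j)
    refine ⟨M, (h.setPoly _ hMk hkc).congr rfl rfl rfl rfl rfl rfl, ?_,
      fun j hj => ⟨(hC j hj).1, (hC j hj).2.trans hl.ge⟩⟩
    rw [Finset.insert_erase hk]
    exact hT.congr hl.ge rfl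
  | reduceUnsafe todo completed k p j hph hk hmin hp hp0 hj hred hlt =>
    simp only [Inv, hph] at h
    obtain ⟨M, h, hT, hC⟩ := h
    obtain ⟨hMk, hkl, hkc⟩ := hT k hk
    have hl := s.length_setPoly k p
    have hj' : 1 ≤ j ∧ j ≤ s.lp.length := by
      rcases Finset.mem_union.1 hj with hj | hj
      · exact h.cur_sub j hj
      · have := hC j hj
        exact ⟨by omega, this.2⟩
    -- The normal form excludes reductors from `G_prev`, so the new signature has index `M + 1` and
    -- its rule enters the current list.
    have hMj : M < j := by
      by_contra hMj
      exact h.not_isReductor hMk hkl hp hp0 hj'.1 (by omega) hred.1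
    have ha : ((s.sig j).mul
        ((s.setPoly k p).head m k - (s.setPoly k p).head m j)).idx = M + 1 :=
      h.sig_idx j hMj hj'.2
    have h1 := (h.setPoly p hMk hkc).append_addRule ((s.setPoly k p).topReduce m k j) ha
    rw [hl] at h1
    have hl' : s.lp.length + 1 ≤ _ := ((length_append_addRule (s.setPoly k p) ((s.sig j).mul
        ((s.setPoly k p).head m k - (s.setPoly k p).head m j))
        ((s.setPoly k p).topReduce m k j) (s.lp.length + 1)).trans (congrArg (· + 1) hl)).ge
    refine ⟨M, h1.congr rfl rfl rfl rfl rfl rfl, ?_,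
      fun j hj => ⟨(hC j hj).1, (hC j hj).2.trans ((Nat.le_succ _).trans hl')⟩⟩
    rw [Finset.insert_erase hk]
    refine (hT.congr ((Nat.le_succ _).trans hl') rfl).insert
      (h.lt_length.trans (Nat.lt_succ_self _)) hl' fun hc => ?_
    exact absurd (h.cur_sub _ hc).2 (Nat.not_succ_le_self _)
  | absorb completed Q hph hQ hQ' =>
    simp only [Inv, hph] at h
    obtain ⟨M, h, -, hC⟩ := h
    refine ⟨M, (h.foldl_absorb Q fun k hk => hC k ?_).congr rfl rfl rfl rfl rfl rfl⟩
    rw [← hQ', List.mem_toFinset]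
    exact hk
  | unit hph hP h1 => exact trivial
  | setup B hph hP h1 hB =>
    refine ⟨isBasePart_setup s B, ?_⟩
    rw [length_setup]
    change State.basisRules m B _ = []
    rw [State.basisRules, if_neg (by omega)]

theorem Reachable.inv {F : List (Poly K n)} (h : Reachable m true F s) : Inv m s := by
  obtain ⟨s₀, h0, h⟩ := h
  induction h with
  | refl => exact h0.inv
  | tail _ hs ih => exact ih.step hs

/-! ### Comparison with the variant. -/

/-- A pair with a component rewritable through a rule for `B` is rejected anyway. -/
theorem Inv.isRewritable_of_findRewriting_eq_zero (h : Inv m s) {c : CritPair n}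
    {L : List (CritPair n)} {N : Finset ℕ} (hph : s.phase = .spol (c :: L) N) :
    s.findRewriting c.u c.k ≠ 0 ∧ (s.findRewriting c.v c.l = 0 →
      s.IsRewritable c.u c.k ∧ s.erase.IsRewritable c.u c.k) := by
  simp only [Inv, hph] at h
  obtain ⟨M, h, -, hdeg, hpw⟩ := h
  obtain ⟨hkc, hMk, hlc, -⟩ := h.pending c (Or.inr (List.mem_cons_self ..))
  have hk := (h.cur_sub _ hkc).2
  obtain ⟨hl1, hl⟩ := h.cur_sub _ hlc
  refine ⟨h.findRewriting_ne_zero hMk hk _, fun h0 => ?_⟩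
  rw [h.erase_isRewritable_iff hMk hk, and_self]
  have hlM : c.l ≤ M := by
    by_contra hlM
    exact h.findRewriting_ne_zero (not_le.1 hlM) hl _ h0
  refine h.isRewritable_of_prev hdeg hpw hlM ?_
  -- The phantom `0` differs from `c.l`, since positions start at `1`.
  rw [State.IsRewritable, h0]
  omega

/-- SPols rejects the same pairs without the rules for `B`. -/
theorem Inv.rejects_erase_iff (h : Inv m s) {c : CritPair n}
    {L : List (CritPair n)} {N : Finset ℕ} (hph : s.phase = .spol (c :: L) N) :
    (s.erase.IsRewritable c.u c.k ∨ s.erase.IsRewritable c.v c.l) ↔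
      (s.IsRewritable c.u c.k ∨ s.IsRewritable c.v c.l) := by
  simp only [Inv, hph] at h
  obtain ⟨M, h, -, hdeg, hpw⟩ := h
  obtain ⟨hkc, hMk, hlc, -⟩ := h.pending c (Or.inr (List.mem_cons_self ..))
  obtain ⟨hl1, hl⟩ := h.cur_sub _ hlc
  rw [h.erase_isRewritable_iff hMk (h.cur_sub _ hkc).2]
  by_cases hlM : c.l ≤ M
  -- Both disjunctions collapse to the rewritability of `k`: without the rules for `B` the other
  -- component is never rewritable, and with them its rewritability implies that of `k`.
  · rw [or_iff_left (h.not_erase_isRewritable hl1 hlM _),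
      or_iff_left_of_imp (h.isRewritable_of_prev hdeg hpw hlM)]
  · rw [h.erase_isRewritable_iff (not_le.1 hlM) hl]

/-- Reduction finds the same reductors without the rules for `B`. -/
theorem Inv.isReductor_erase_iff (h : Inv m s) {todo completed : Finset ℕ}
    (hph : s.phase = .reduction todo completed) {k j : ℕ} {p : Poly K n} (hk : k ∈ todo)
    (hp : IsNormalForm m s.B (s.poly k) p) (hp0 : p ≠ 0) (hj : j ∈ s.cur ∪ completed) :
    (s.erase.setPoly k p).IsReductor m k j ↔ (s.setPoly k p).IsReductor m k j := by
  simp only [Inv, hph] at h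
  obtain ⟨M, h, hT, hC⟩ := h
  obtain ⟨hMk, hkl, hkc⟩ := hT k hk
  have hj' : 1 ≤ j ∧ j ≤ s.lp.length := by
    rcases Finset.mem_union.1 hj with hj | hj
    · exact h.cur_sub j hj
    · have := hC j hj
      exact ⟨by omega, this.2⟩
  by_cases hjM : j ≤ M
  -- Divisibility of the head monomials already fails, so the rules do not matter.
  · have := h.not_isReductor hMk hkl hp hp0 hj'.1 hjM
    exact iff_of_false (fun hr => this hr.1) (fun hr => this hr.1)
  · refine and_congr Iff.rfl (and_congr Iff.rfl (and_congr (not_congr ?_) Iff.rfl))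
    exact (h.setPoly p hMk hkc).erase_isRewritable_iff (not_le.1 hjM)
      (hj'.2.trans (s.length_setPoly k p).ge) _

theorem erase_addRule_phase (s : State K n) (a : Sig n) {j : ℕ} (hj : j ≠ 0) (P : Phase K n) :
    State.erase { s.addRule a j with phase := P } = { s.erase.addRule a j with phase := P } :=
  congrArg (fun x : State K n => ({ x with phase := P } : State K n)) (s.erase_addRule a hj)

/-- Rules influence a step only through the rejection test of SPols and the search for a reductor;
both have the same results after erasure. -/
theorem Inv.step_erase (h : Inv m s) (hs : Step m true s s') :
    Step m false s.erase s'.erase := by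
  cases hs with
  | output hph hr => exact .output s.erase hph hr
  | begin f fs hph hr => exact .begin s.erase f fs hph hr
  | batch L hph hL => exact .batch s.erase L hph hL
  | reject c L N hph hc => exact .reject s.erase c L N hph ((h.rejects_erase_iff hph).2 hc)
  | computeZero c L N hph hk hl hs =>
    have hkl := not_or.1 (mt (h.rejects_erase_iff hph).1 (not_or.2 ⟨hk, hl⟩))
    rw [erase_addRule_phase _ _ (Nat.succ_ne_zero _)]
    exact .computeZero s.erase c L N hph hkl.1 hkl.2 hs
  | compute c L N hph hk hl hs =>
    have hkl := not_or.1 (mt (h.rejects_erase_iff hph).1 (not_or.2 ⟨hk, hl⟩))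
    rw [erase_addRule_phase _ _ (Nat.succ_ne_zero _)]
    exact .compute s.erase c L N hph hkl.1 hkl.2 hs
  | reduce N hph => exact .reduce s.erase N hph
  | reduceZero todo completed k p hph hk hmin hp hp0 =>
    exact .reduceZero s.erase todo completed k p hph hk hmin hp hp0
  | reduceDone todo completed k p hph hk hmin hp hp0 hj =>
    exact .reduceDone s.erase todo completed k p hph hk hmin hp hp0
      fun j hj' => mt (h.isReductor_erase_iff hph hk hp hp0 hj').1 (hj j hj')
  | reduceSafe todo completed k p j hph hk hmin hp hp0 hj hred hlt =>
    exact .reduceSafe s.erase todo completed k p j hph hk hmin hp hp0 hj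
      ((h.isReductor_erase_iff hph hk hp hp0 hj).2 hred) hlt
  | reduceUnsafe todo completed k p j hph hk hmin hp hp0 hj hred hlt =>
    rw [erase_addRule_phase _ _ (Nat.succ_ne_zero _)]
    exact .reduceUnsafe s.erase todo completed k p j hph hk hmin hp hp0 hj
      ((h.isReductor_erase_iff hph hk hp hp0 hj).2 hred) hlt
  | absorb completed Q hph hQ hQ' =>
    have := Step.absorb (m := m) (recreate := false) s.erase completed Q hph hQ hQ'
    rw [← State.erase_foldl_absorb] at this
    exact this
  | unit hph hP h1 => exact .unit s.erase hph hP h1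
  | setup B hph hP h1 hB =>
    rw [State.erase_setup]
    exact .setup s.erase B hph hP h1 hB

theorem Inv.exists_step_of_erase (h : Inv m s) (hs : Step m false s.erase s') :
    ∃ s₁, Step m true s s₁ ∧ s₁.erase = s' := by
  cases hs with
  | output hph hr => exact ⟨_, .output s hph hr, rfl⟩
  | begin f fs hph hr => exact ⟨_, .begin s f fs hph hr, rfl⟩
  | batch L hph hL => exact ⟨_, .batch s L hph hL, rfl⟩
  | reject c L N hph hc =>
    exact ⟨_, .reject s c L N hph ((h.rejects_erase_iff hph).1 hc), rfl⟩
  | computeZero c L N hph hk hl hs =>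
    have hkl := not_or.1 (mt (h.rejects_erase_iff hph).2 (not_or.2 ⟨hk, hl⟩))
    exact ⟨_, .computeZero s c L N hph hkl.1 hkl.2 hs,
      erase_addRule_phase _ _ (Nat.succ_ne_zero _) _⟩
  | compute c L N hph hk hl hs =>
    have hkl := not_or.1 (mt (h.rejects_erase_iff hph).2 (not_or.2 ⟨hk, hl⟩))
    exact ⟨_, .compute s c L N hph hkl.1 hkl.2 hs,
      erase_addRule_phase _ _ (Nat.succ_ne_zero _) _⟩
  | reduce N hph => exact ⟨_, .reduce s N hph, rfl⟩
  | reduceZero todo completed k p hph hk hmin hp hp0 =>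
    exact ⟨_, .reduceZero s todo completed k p hph hk hmin hp hp0, rfl⟩
  | reduceDone todo completed k p hph hk hmin hp hp0 hj =>
    exact ⟨_, .reduceDone s todo completed k p hph hk hmin hp hp0
      fun j hj' => mt (h.isReductor_erase_iff hph hk hp hp0 hj').2 (hj j hj'), rfl⟩
  | reduceSafe todo completed k p j hph hk hmin hp hp0 hj hred hlt =>
    exact ⟨_, .reduceSafe s todo completed k p j hph hk hmin hp hp0 hj
      ((h.isReductor_erase_iff hph hk hp hp0 hj).1 hred) hlt, rfl⟩
  | reduceUnsafe todo completed k p j hph hk hmin hp hp0 hj hred hlt =>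
    exact ⟨_, .reduceUnsafe s todo completed k p j hph hk hmin hp hp0 hj
      ((h.isReductor_erase_iff hph hk hp hp0 hj).1 hred) hlt,
      erase_addRule_phase _ _ (Nat.succ_ne_zero _) _⟩
  | absorb completed Q hph hQ hQ' =>
    refine ⟨_, .absorb s completed Q hph hQ hQ', ?_⟩
    exact congrArg (fun x : State K n => ({ x with phase := .loop } : State K n))
      (State.erase_foldl_absorb Q s)
  | unit hph hP h1 => exact ⟨_, .unit s hph hP h1, rfl⟩
  | setup B hph hP h1 hB => exact ⟨_, .setup s B hph hP h1 hB, State.erase_setup s B⟩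

theorem IsInit.erase_eq {F : List (Poly K n)} (h : IsInit m F s) : s.erase = s := by
  obtain ⟨f, fs, -, -, rfl⟩ := h
  rfl

theorem Reachable.erase {F : List (Poly K n)} (h : Reachable m true F s) :
    Reachable m false F s.erase := by
  obtain ⟨s₀, h0, h⟩ := h
  induction h with
  | refl => exact ⟨s₀, h0, by rw [h0.erase_eq]⟩
  | tail hr hs ih =>
    obtain ⟨s₁, h1, h2⟩ := ih
    exact ⟨s₁, h1, h2.tail (Inv.step_erase (Reachable.inv ⟨s₀, h0, hr⟩) hs)⟩

/-- The execution is lifted step by step, because the invariant is available only for the states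
with the rules for `B`. -/
theorem Reachable.exists_erase_eq {F : List (Poly K n)} (h : Reachable m false F s) :
    ∃ s₁, Reachable m true F s₁ ∧ s₁.erase = s := by
  obtain ⟨s₀, h0, h⟩ := h
  induction h with
  | refl => exact ⟨s₀, ⟨s₀, h0, .refl⟩, h0.erase_eq⟩
  | tail _ hs ih =>
    obtain ⟨s₁, ⟨s₂, h2, hr⟩, rfl⟩ := ih
    obtain ⟨s₃, h3, h4⟩ := (Reachable.inv ⟨s₂, h2, hr⟩).exists_step_of_erase hs
    exact ⟨s₃, ⟨s₂, h2, hr.tail h3⟩, h4⟩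

end Invariant

end F5C

theorem mainTheorem5 {K : Type*} [Field K] {n : ℕ} (m : MonomialOrder (Fin n))
    (F : List (MvPolynomial (Fin n) K)) (hF0 : ∀ f ∈ F, f ≠ 0)
    (hF : ∀ f ∈ F, ∃ d : ℕ, f.IsHomogeneous d) :
    -- If SPols finds that one component of a pair is rewritable through a rule for `B` (a rule
    -- that points to the phantom polynomial `0`), then the other component is rewritable, even
    -- if all rules for `B` are ignored.
    (∀ s, F5C.Reachable m true F s → ∀ c L N, s.phase = F5C.Phase.spol (c :: L) N →
      (s.findRewriting c.v c.l = 0 →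
        s.IsRewritable c.u c.k ∧ s.erase.IsRewritable c.u c.k) ∧
      (s.findRewriting c.u c.k = 0 →
        s.IsRewritable c.v c.l ∧ s.erase.IsRewritable c.v c.l)) ∧
    -- The executions with and without the rules for `B` correspond step by step, and differ in
    -- nothing but these rules.
    (∀ s, F5C.Reachable m true F s →
      F5C.Reachable m false F s.erase ∧
      (∀ s', F5C.Step m true s s' → F5C.Step m false s.erase s'.erase) ∧
      (∀ s'', F5C.Step m false s.erase s'' → ∃ s', F5C.Step m true s s' ∧ s'.erase = s'')) ∧
    -- Every execution without the rules arises in this way.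
    (∀ s', F5C.Reachable m false F s' → ∃ s, F5C.Reachable m true F s ∧ s.erase = s') ∧
    -- In particular the same outputs are obtained.
    (∀ G, F5C.Outputs m true F G ↔ F5C.Outputs m false F G) := by
  refine ⟨fun s hs c L N hph => ?_, fun s hs => ⟨hs.erase, fun s' h => hs.inv.step_erase h,
    fun s'' h => hs.inv.exists_step_of_erase h⟩, fun s' hs => hs.exists_erase_eq, fun G => ⟨?_, ?_⟩⟩
  · have h := hs.inv.isRewritable_of_findRewriting_eq_zero hph
    -- The first component never returns `0`, so the second implication is vacuous.
    exact ⟨h.2, fun h0 => absurd h0 h.1⟩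
  · rintro ⟨s, hs, hG⟩
    exact ⟨s.erase, hs.erase, hG⟩
  · rintro ⟨s', hs', hG⟩
    obtain ⟨s, hs, rfl⟩ := hs'.exists_erase_eq
    exact ⟨s, hs, hG⟩
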